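/- Let $H$ be a complex Hilbert space. By a projection we mean an orthogonal projection onto a closed subspace of $H$. For a bounded operator $T$ on $H$, let $\|T\|_C$ denote the norm of the class of $T$ in the Calkin algebra $\mathcal B(H)/\mathcal K(H)$ (bounded operators modulo compact operators, with the quotient norm). A pair $(Q,P)$ of projections is called a Fredholm pair if the restricted operator $P\colon \operatorname{Ran}(Q)\to\operatorname{Ran}(P)$, $x\mapsto Px$, is a Fredholm operator; its index is $\operatorname{ind}(Q,P):=\dim\operatorname{Ker}-\dim\operatorname{Coker}$ of this restricted operator. Let $P$, $P'$, $S$ be projections in $H$ with $$\|P-S\|_C^2+\|P'-S\|_C^2<1.$$ Then $(P,P')$, $(P,S)$ and $(S,P')$ are Fredholm pairs, and $$\operatorname{ind}(P,P')=\operatorname{ind}(P,S)+\operatorname{ind}(S,P').$$ -/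

import Mathlib

noncomputable section

variable {H : Type*} [NormedAddCommGroup H] [InnerProductSpace ℂ H]

/-- The Calkin algebra `B(H) / K(H)`: bounded operators modulo compact operators,
with its quotient norm. -/
abbrev CalkinAlgebra (H : Type*) [NormedAddCommGroup H] [InnerProductSpace ℂ H] : Type _ :=
  (H →L[ℂ] H) ⧸ compactOperator (RingHom.id ℂ) H H

/-- The Calkin norm `‖T‖_C`: the quotient norm of the class of `T` in the Calkin algebra. -/
def calkinNorm (T : H →L[ℂ] H) : ℝ :=
  ‖(Submodule.Quotient.mk T : CalkinAlgebra H)‖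

/-- The index `dim Ker T - dim Coker T`, where `Coker T = F / Ran T`
(meaningful when `T` is Fredholm). -/
def fredholmIndex {E F : Type*} [NormedAddCommGroup E] [InnerProductSpace ℂ E]
    [NormedAddCommGroup F] [InnerProductSpace ℂ F] (T : E →L[ℂ] F) : ℤ :=
  (Module.finrank ℂ T.ker : ℤ) - (Module.finrank ℂ (F ⧸ T.range) : ℤ)

/-- The restricted operator `P : Ran Q → Ran P`, `x ↦ P x`, of the pair `(Q, P)`. -/
def pairOperator (Q P : H →L[ℂ] H) : Q.range →L[ℂ] P.range :=
  (P ∘L Q.range.subtypeL).codRestrict P.range (fun x => ⟨(x : H), rfl⟩)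

/-- The pair `(Q, P)` is a Fredholm pair: `P : Ran Q → Ran P` is a Fredholm operator. -/
def IsFredholmPair (Q P : H →L[ℂ] H) : Prop :=
  (pairOperator Q P).IsFredholm

/-- The index of the pair `(Q, P)`: the index of `P : Ran Q → Ran P`. -/
def pairIndex (Q P : H →L[ℂ] H) : ℤ :=
  fredholmIndex (pairOperator Q P)

end

/-!
The relation `u ≈ v` below means that `u - v` has finite rank.

Put `A = S : Ran P → Ran S` and `B = P' : Ran S → Ran P'`. The operator `T = P' : Ran P → Ran P'`
splits along `Ran S` and its orthogonal complement as `T = B A + B' A'`, where `A' = 1 - S` on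
`Ran P` and `B' = P' (1 - S)`. It is shown that `T ≈ B U A` for some invertible operator `U` of
`Ran S` (`exists_pairOperator_equiv_comp`). Since `A` and `B` are Fredholm, since the index is
additive under composition and does not change under finite-rank perturbations, and since `U` has
index zero, the theorem follows.

Compact operators on a Hilbert space are norm limits of operators of finite rank, so a bound
`‖P - S‖_C < c` provides an operator `G ≈ P - S` with `‖G‖ < c`
(`exists_equiv_of_calkinNorm_lt`). If `c < 1`, then `P S = 1 - P (P - S)` on `Ran P` is invertible
modulo finite rank, and the same holds with `P` and `S` exchanged, so `A` is Fredholm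
(`isFredholmPair_of_equiv`).

Let `a` be a quasi-inverse of `A`. On a closed subspace of finite codimension of `Ran S`, a vector
`x` satisfies `S (a x) = x` and `‖(1 - S) (a x)‖ ≤ c ‖a x‖`, so Pythagoras yields
`‖(1 - S) (a x)‖ ≤ c / √(1 - c²) ‖x‖`: the tangent of the angle between the two ranges is bounded
because its sine is. Thus `A' a` agrees modulo finite rank with an operator `W` of norm at most
`c / √(1 - c²)` (`exists_tangent_equiv`). The same argument for the pair `(P', S)`, with a bound
`c'` and a quasi-inverse `b` of `S : Ran P' → Ran S`, produces an operator `W'`, and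
`b† T a ≈ 1 + W'† W`. The hypothesis `c² + c'² < 1` says precisely that the product of the two
tangents is less than `1`, so `U = 1 + W'† W` is invertible. Multiplying by `B` on the left and by
`A` on the right, which are quasi-inverse to `b†` and `a`, gives `T ≈ B U A`.
-/

open scoped LinearMap.FiniteRangeSetoid InnerProductSpace
open LinearMap.FiniteRangeSetoid ContinuousLinearMap

/-! ### Linear maps modulo finite rank -/

section Algebra

variable {K V W : Type*} [Field K] [AddCommGroup V] [Module K V] [AddCommGroup W] [Module K W]

namespace LinearMap.FiniteRangeSetoid

lemma equiv_add {u u' v v' : V →ₗ[K] W} (h : u ≈ u') (h' : v ≈ v') : u + v ≈ u' + v' := by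
  rw [equiv_iff_hasNoetherianRange] at *
  rw [add_sub_add_comm]
  exact h.add h'

lemma equiv_neg {u v : V →ₗ[K] W} (h : u ≈ v) : -u ≈ -v := by
  rw [equiv_iff_hasNoetherianRange] at *
  rw [neg_sub_neg, ← neg_sub]
  exact h.neg

end LinearMap.FiniteRangeSetoid

/-- The index is invariant under perturbations of finite rank: both maps have the same composition
with the inclusion of the subspace of finite codimension on which they agree. -/
lemma LinearMap.index_eq_of_equiv {u v : V →ₗ[K] W} (h : u ≈ v)
    [FiniteDimensional K u.ker] [FiniteDimensional K (W ⧸ u.range)]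
    [FiniteDimensional K v.ker] [FiniteDimensional K (W ⧸ v.range)] :
    u.index = v.index := by
  set A := LinearMap.eqLocus u v
  have hA : FiniteDimensional K (V ⧸ A) := equiv_iff_eqLocus_coFG.mp h
  have : FiniteDimensional K A.subtype.ker := by rw [Submodule.ker_subtype]; infer_instance
  have : FiniteDimensional K (V ⧸ A.subtype.range) := by rwa [Submodule.range_subtype]
  have huv : u ∘ₗ A.subtype = v ∘ₗ A.subtype := by
    ext x
    exact x.2
  have hu := LinearMap.index_comp (f := A.subtype) u
  have hv := LinearMap.index_comp (f := A.subtype) v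
  rw [huv] at hu
  omega

end Algebra

/-! ### Bounded operators modulo finite rank -/

section Hilbert

variable {𝕜 E F : Type*} [RCLike 𝕜] [NormedAddCommGroup E] [InnerProductSpace 𝕜 E]
  [NormedAddCommGroup F] [InnerProductSpace 𝕜 F]

namespace ContinuousLinearMap

lemma adjoint_equiv [CompleteSpace E] [CompleteSpace F] {u v : E →L[𝕜] F} (h : (u : E →ₗ[𝕜] F) ≈ v) :
    (u.adjoint : F →ₗ[𝕜] E) ≈ v.adjoint := by
  rw [equiv_iff_hasFiniteRange] at *
  let R : Submodule 𝕜 F := (u - v).range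
  have : FiniteDimensional 𝕜 R := .of_fg h
  have hR : R.starProjection ∘L (u - v) = u - v := by
    ext x
    exact Submodule.starProjection_eq_self_iff.mpr ⟨x, rfl⟩
  have hadj : u.adjoint - v.adjoint = (u - v).adjoint ∘L R.starProjection := by
    conv_lhs => rw [← map_sub, ← hR, adjoint_comp]
    rw [(isSelfAdjoint_starProjection R).adjoint_eq]
  have hfin : (R.starProjection : F →ₗ[𝕜] F).HasFiniteRange := by
    rw [LinearMap.HasFiniteRange, Submodule.range_starProjection]
    exact h
  have := hfin.comp_left ((u - v).adjoint : F →ₗ[𝕜] E)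
  rw [← toLinearMap_comp, ← hadj] at this
  exact this

/-- An operator bounded by `c` on a closed subspace of finite codimension agrees modulo finite rank
with an operator of norm at most `c`, namely its composition with the orthogonal projection onto
that subspace. -/
lemma exists_norm_le_equiv_of_coFG [CompleteSpace E] (W : E →L[𝕜] F) {N : Submodule 𝕜 E}
    (hN : IsClosed (N : Set E)) (hfin : N.CoFG) {c : ℝ} (hc : 0 ≤ c)
    (hW : ∀ x ∈ N, ‖W x‖ ≤ c * ‖x‖) :
    ∃ W₁ : E →L[𝕜] F, ‖W₁‖ ≤ c ∧ (W : E →ₗ[𝕜] F) ≈ W₁ := by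
  have : CompleteSpace N := hN.completeSpace_coe
  refine ⟨W ∘L N.starProjection, opNorm_le_bound _ hc fun x => ?_,
    equiv_of_eqOn_coFG hfin fun x hx => ?_⟩
  · refine (hW _ (Submodule.starProjection_apply_mem N x)).trans ?_
    gcongr
    exact Submodule.norm_starProjection_apply_le N x
  · change W x = W (N.starProjection x)
    rw [Submodule.starProjection_eq_self_iff.mpr hx]

/-- A compact operator into an inner product space is a norm limit of operators of finite rank:
compose it with the orthogonal projection onto the span of a finite `ε`-net of the image of the
unit ball. -/
lemma exists_hasFiniteRange_of_isCompactOperator {K : E →L[𝕜] F} (hK : IsCompactOperator K)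
    {ε : ℝ} (hε : 0 < ε) :
    ∃ K₁ : E →L[𝕜] F, (K₁ : E →ₗ[𝕜] F).HasFiniteRange ∧ ‖K - K₁‖ ≤ ε := by
  obtain ⟨t, ht, hcov⟩ := Metric.totallyBounded_iff.mp
    ((hK.isCompact_closure_image_closedBall (1 : ℝ)).totallyBounded.subset subset_closure) ε hε
  let R : Submodule 𝕜 F := Submodule.span 𝕜 t
  have : FiniteDimensional 𝕜 R := FiniteDimensional.span_of_finite 𝕜 ht
  refine ⟨R.starProjection ∘L K, ?_, opNorm_le_of_unit_norm hε.le fun x hx => ?_⟩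
  · refine LinearMap.HasFiniteRange.comp_right (v := (R.starProjection : F →ₗ[𝕜] F)) ?_ _
    rw [LinearMap.HasFiniteRange, Submodule.range_starProjection]
    exact Submodule.FG.of_finite
  · obtain ⟨y, hy, hxy⟩ := Set.mem_iUnion₂.mp
      (hcov (Set.mem_image_of_mem K (mem_closedBall_zero_iff.mpr hx.le)))
    -- `y` is fixed by the projection onto `R`, which therefore moves `K x` by at most `‖K x - y‖`
    have hyR : R.starProjection y = y :=
      Submodule.starProjection_eq_self_iff.mpr (Submodule.subset_span hy)
    have hres : (K - R.starProjection ∘L K) x = Rᗮ.starProjection (K x - y) := by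
      rw [Submodule.starProjection_orthogonal']
      simp [hyR]
    rw [hres]
    refine (Submodule.norm_starProjection_apply_le _ _).trans ?_
    rw [← dist_eq_norm]
    exact (Metric.mem_ball.mp hxy).le

lemma exists_continuousLinearEquiv_eq_one_sub [CompleteSpace E] {X : E →L[𝕜] E} (hX : ‖X‖ < 1) :
    ∃ U : E ≃L[𝕜] E, (U : E →L[𝕜] E) = 1 - X :=
  ⟨.ofUnit (Units.oneSub X hX), rfl⟩

/-- An operator invertible modulo finite rank after composition with `v` on either side is
Fredholm. -/
lemma isFredholm_of_comp_equiv {u : E →L[𝕜] F} {v : F →L[𝕜] E}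
    {U : E ≃L[𝕜] E} {U' : F ≃L[𝕜] F}
    (hU : (v ∘L u : E →ₗ[𝕜] E) ≈ (U : E →L[𝕜] E))
    (hU' : (u ∘L v : F →ₗ[𝕜] F) ≈ (U' : F →L[𝕜] F)) :
    u.IsFredholm := by
  have hl : ((U.symm : E →L[𝕜] E) ∘L v : F →ₗ[𝕜] E).IsLeftQuasiInverse (u : E →ₗ[𝕜] F) := by
    have h := equiv_comp_left (u' := ((U.symm : E →L[𝕜] E) : E →ₗ[𝕜] E)) hU
    have hid : ((U.symm : E →L[𝕜] E) : E →ₗ[𝕜] E) ∘ₗ ((U : E →L[𝕜] E) : E →ₗ[𝕜] E) = .id := by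
      ext x; exact U.symm_apply_apply x
    rwa [hid] at h
  have hr : (u : E →ₗ[𝕜] F) ∘ₗ (v ∘L (U'.symm : F →L[𝕜] F) : F →ₗ[𝕜] E) ≈ .id := by
    have h := equiv_comp_right (u := ((U'.symm : F →L[𝕜] F) : F →ₗ[𝕜] F)) hU'
    have hid : ((U' : F →L[𝕜] F) : F →ₗ[𝕜] F) ∘ₗ ((U'.symm : F →L[𝕜] F) : F →ₗ[𝕜] F) = .id := by
      ext x; exact U'.apply_symm_apply x
    rwa [hid] at h
  -- a left and a right quasi-inverse agree modulo finite rank: `l ≈ l u r ≈ r`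
  have hlr : ((U.symm : E →L[𝕜] E) ∘L v : F →ₗ[𝕜] E) ≈
      (v ∘L (U'.symm : F →L[𝕜] F) : F →ₗ[𝕜] E) :=
    Setoid.trans
      (Setoid.symm (equiv_comp_left (u' := ((U.symm : E →L[𝕜] E) ∘L v : F →ₗ[𝕜] E)) hr))
      (equiv_comp_right (u := (v ∘L (U'.symm : F →L[𝕜] F) : F →ₗ[𝕜] E)) hl)
  exact .of_isQuasiInverse
    ⟨hl, Setoid.trans (equiv_comp_left (u' := (u : E →ₗ[𝕜] F)) hlr) hr⟩

end ContinuousLinearMap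

end Hilbert

/-! ### Pairs of projections -/

section Pairs

variable {H : Type*} [NormedAddCommGroup H] [InnerProductSpace ℂ H]

lemma exists_equiv_of_calkinNorm_lt {T : H →L[ℂ] H} {c : ℝ}
    (h : calkinNorm T < c) : ∃ G : H →L[ℂ] H, ‖G‖ < c ∧ (T : H →ₗ[ℂ] H) ≈ G := by
  obtain ⟨G₀, hG₀, hlt⟩ := Submodule.Quotient.norm_mk_lt
    (Submodule.Quotient.mk T : CalkinAlgebra H) (half_pos (sub_pos.mpr h))
  have hK : IsCompactOperator (T - G₀) := (Submodule.Quotient.eq _).mp hG₀.symm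
  obtain ⟨K₁, hfin, hK₁⟩ :=
    exists_hasFiniteRange_of_isCompactOperator (K := T - G₀) hK
      (half_pos (half_pos (sub_pos.mpr h)))
  refine ⟨T - K₁, ?_, ?_⟩
  · change ‖G₀‖ < calkinNorm T + _ at hlt
    calc ‖T - K₁‖ = ‖G₀ + (T - G₀ - K₁)‖ := by congr 1; abel
      _ ≤ ‖G₀‖ + ‖T - G₀ - K₁‖ := norm_add_le _ _
      _ < c := by linarith
  · rw [equiv_iff_hasFiniteRange]
    have : (T : H →ₗ[ℂ] H) - ((T - K₁ : H →L[ℂ] H) : H →ₗ[ℂ] H) = K₁ := by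
      ext x; simp
    rwa [this]

lemma sub_swap_equiv_neg {P S G : H →L[ℂ] H}
    (hPS : ((P - S : H →L[ℂ] H) : H →ₗ[ℂ] H) ≈ G) :
    ((S - P : H →L[ℂ] H) : H →ₗ[ℂ] H) ≈ (-G : H →L[ℂ] H) := by
  have h := equiv_neg hPS
  rwa [show -((P - S : H →L[ℂ] H) : H →ₗ[ℂ] H) = (S - P : H →L[ℂ] H) by ext; simp] at h

variable [CompleteSpace H]

lemma IsStarProjection.apply_apply_self {P : H →L[ℂ] H}
    (hP : IsStarProjection P) (x : H) : P (P x) = P x :=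
  congr($(hP.isIdempotentElem.eq) x)

lemma IsStarProjection.apply_coe_range {P : H →L[ℂ] H}
    (hP : IsStarProjection P) (x : P.range) : P x = x := by
  obtain ⟨x, y, rfl⟩ := x
  exact hP.apply_apply_self y

lemma IsStarProjection.inner_apply_left {P : H →L[ℂ] H}
    (hP : IsStarProjection P) (x y : H) : ⟪P x, y⟫_ℂ = ⟪x, P y⟫_ℂ := by
  have h : P.adjoint = P := hP.isSelfAdjoint.adjoint_eq
  rw [← ContinuousLinearMap.adjoint_inner_right, h]

lemma IsStarProjection.completeSpace_range {P : H →L[ℂ] H}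
    (hP : IsStarProjection P) : CompleteSpace P.range :=
  (ContinuousLinearMap.IsIdempotentElem.isClosed_range hP.isIdempotentElem).completeSpace_coe

lemma IsStarProjection.norm_apply_le {P : H →L[ℂ] H}
    (hP : IsStarProjection P) (x : H) : ‖P x‖ ≤ ‖x‖ := by
  simpa using P.le_of_opNorm_le hP.norm_le x

lemma IsStarProjection.inner_eq_inner_add_inner {P : H →L[ℂ] H} (hP : IsStarProjection P) (x y : H) :
    ⟪x, y⟫_ℂ = ⟪P x, P y⟫_ℂ + ⟪x - P x, y - P y⟫_ℂ := by
  have h1 := hP.inner_apply_left x (P y)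
  have h2 := hP.inner_apply_left x y
  rw [hP.apply_apply_self] at h1
  rw [inner_sub_left, inner_sub_right, inner_sub_right, h1, h2]
  ring

lemma adjoint_pairOperator {P S : H →L[ℂ] H} (hP : IsStarProjection P)
    (hS : IsStarProjection S) [CompleteSpace P.range] [CompleteSpace S.range] :
    (pairOperator P S).adjoint = pairOperator S P := by
  refine ((eq_adjoint_iff _ _).mpr fun x y => ?_).symm
  change ⟪P x, (y : H)⟫_ℂ = ⟪(x : H), S y⟫_ℂ
  rw [hP.inner_apply_left, hP.apply_coe_range, ← hS.inner_apply_left, hS.apply_coe_range]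

/-- If `P - S` is a contraction modulo finite rank, then `P S = 1 - P (P - S)` is invertible modulo
finite rank on the range of `P`. -/
lemma exists_pairOperator_comp_equiv {P S : H →L[ℂ] H}
    (hP : IsStarProjection P) [CompleteSpace P.range]
    {G : H →L[ℂ] H} (hG : ‖G‖ < 1) (hPS : ((P - S : H →L[ℂ] H) : H →ₗ[ℂ] H) ≈ G) :
    ∃ U : P.range ≃L[ℂ] P.range,
      (pairOperator S P ∘L pairOperator P S : P.range →ₗ[ℂ] P.range) ≈
        (U : P.range →L[ℂ] P.range) := by
  let R : H →L[ℂ] P.range := P.codRestrict P.range fun x => ⟨x, rfl⟩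
  obtain ⟨U, hU⟩ := exists_continuousLinearEquiv_eq_one_sub (X := R ∘L G ∘L P.range.subtypeL) <| by
    refine (opNorm_le_bound _ (norm_nonneg G) fun x => ?_).trans_lt hG
    change ‖P (G x)‖ ≤ _
    exact (hP.norm_apply_le _).trans (G.le_opNorm x)
  refine ⟨U, ?_⟩
  have hcomp : (pairOperator S P ∘L pairOperator P S : P.range →ₗ[ℂ] P.range) =
      LinearMap.id + -((R : H →ₗ[ℂ] P.range) ∘ₗ ((P - S : H →L[ℂ] H) : H →ₗ[ℂ] H) ∘ₗ
        P.range.subtype) := by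
    ext x
    change P (S x) = x + -(P (P x - S x))
    rw [map_sub, hP.apply_coe_range, hP.apply_coe_range]
    abel
  have hU' : ((U : P.range →L[ℂ] P.range) : P.range →ₗ[ℂ] P.range) =
      LinearMap.id + -((R : H →ₗ[ℂ] P.range) ∘ₗ (G : H →ₗ[ℂ] H) ∘ₗ P.range.subtype) := by
    rw [hU]
    exact sub_eq_add_neg _ _
  rw [hcomp, hU']
  exact equiv_add (Setoid.refl _) (equiv_neg (equiv_comp_left (equiv_comp_right hPS)))

lemma isFredholmPair_of_equiv {P S : H →L[ℂ] H}
    (hP : IsStarProjection P) (hS : IsStarProjection S)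
    {G : H →L[ℂ] H} (hG : ‖G‖ < 1) (hPS : ((P - S : H →L[ℂ] H) : H →ₗ[ℂ] H) ≈ G) :
    IsFredholmPair P S := by
  have := hP.completeSpace_range
  have := hS.completeSpace_range
  obtain ⟨U, hU⟩ := exists_pairOperator_comp_equiv hP hG hPS
  obtain ⟨U', hU'⟩ := exists_pairOperator_comp_equiv hS (by rwa [norm_neg]) (sub_swap_equiv_neg hPS)
  exact isFredholm_of_comp_equiv hU hU'

/-- Let `a` be a right quasi-inverse of `S : Ran P → Ran S`. If `P - S` has norm at most `c < 1`
modulo finite rank (the sine of the angle between the ranges), then `(1 - S) a` has norm at most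
`c / √(1 - c ^ 2)` modulo finite rank (the tangent of that angle). -/
lemma exists_tangent_equiv {P S : H →L[ℂ] H}
    (hP : IsStarProjection P) (hS : IsStarProjection S)
    {G : H →L[ℂ] H} {c : ℝ} (hc : c < 1) (hG : ‖G‖ ≤ c)
    (hPS : ((P - S : H →L[ℂ] H) : H →ₗ[ℂ] H) ≈ G)
    {a : S.range →L[ℂ] P.range}
    (ha : (pairOperator P S : P.range →ₗ[ℂ] S.range) ∘ₗ (a : S.range →ₗ[ℂ] P.range) ≈ .id) :
    ∃ W : S.range →L[ℂ] H, ‖W‖ ≤ c / √(1 - c ^ 2) ∧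
      (((1 - S : H →L[ℂ] H) ∘L P.range.subtypeL ∘L a : S.range →L[ℂ] H) : S.range →ₗ[ℂ] H) ≈
        W := by
  have := hS.completeSpace_range
  have hc0 : 0 ≤ c := (norm_nonneg G).trans hG
  have hpos : 0 < 1 - c ^ 2 := by nlinarith
  -- where `S (a x) = x`, and where `P - S` coincides with `G` on `a x`
  let N₁ := (pairOperator P S ∘L a).eqLocus (ContinuousLinearMap.id ℂ S.range : S.range →ₗ[ℂ] S.range)
  let N₂ := ((P - S) ∘L P.range.subtypeL ∘L a).eqLocus (G ∘L P.range.subtypeL ∘L a)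
  have h₁ : N₁.CoFG := equiv_iff_eqLocus_coFG.mp ha
  have h₂ : N₂.CoFG := equiv_iff_eqLocus_coFG.mp
    (equiv_comp_right (u := ((P.range.subtypeL ∘L a : S.range →L[ℂ] H) : S.range →ₗ[ℂ] H)) hPS)
  have hclosed : IsClosed ((N₁ ⊓ N₂ : Submodule ℂ S.range) : Set S.range) :=
    (isClosed_eqLocus (pairOperator P S ∘L a) (ContinuousLinearMap.id ℂ S.range)).inter
      (isClosed_eqLocus ((P - S) ∘L P.range.subtypeL ∘L a) (G ∘L P.range.subtypeL ∘L a))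
  refine exists_norm_le_equiv_of_coFG _ hclosed (h₁.inf h₂) (by positivity) ?_
  rintro x ⟨hx₁, hx₂⟩
  replace hx₁ : S (a x) = x := congr(($hx₁ : H))
  replace hx₂ : P (a x) - S (a x) = G (a x) := hx₂
  rw [hP.apply_coe_range] at hx₂
  change ‖(a x : H) - S (a x)‖ ≤ _ * ‖(x : H)‖
  have hle : ‖(a x : H) - S (a x)‖ ≤ c * ‖(a x : H)‖ := by
    rw [hx₂]
    exact G.le_of_opNorm_le hG _
  have hpyth : ‖(a x : H)‖ ^ 2 = ‖(x : H)‖ ^ 2 + ‖(a x : H) - S (a x)‖ ^ 2 := by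
    have h := hS.inner_eq_inner_add_inner (a x : H) (a x)
    rw [hx₁] at h ⊢
    simp only [inner_self_eq_norm_sq_to_K] at h
    exact_mod_cast h
  rw [div_mul_eq_mul_div, le_div_iff₀ (by positivity)]
  refine le_of_sq_le_sq ?_ (by positivity)
  rw [mul_pow, mul_pow, Real.sq_sqrt hpos.le]
  nlinarith [pow_le_pow_left₀ (norm_nonneg _) hle 2]

end Pairs

/-! ### Fredholm operators and their index -/

section Additivity

variable {E F G : Type*} [NormedAddCommGroup E] [InnerProductSpace ℂ E]
  [NormedAddCommGroup F] [InnerProductSpace ℂ F] [NormedAddCommGroup G] [InnerProductSpace ℂ G]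

namespace ContinuousLinearMap

lemma IsFredholm.congr {u v : E →L[ℂ] F} (hu : u.IsFredholm)
    (h : (u : E →ₗ[ℂ] F) ≈ v) : v.IsFredholm := by
  obtain ⟨w, hw⟩ := hu.exists_isQuasiInverse
  exact .of_isQuasiInverse (hw.congr (Setoid.refl _) (Setoid.symm h))

lemma IsFredholm.comp {u : E →L[ℂ] F} {v : F →L[ℂ] G} (hv : v.IsFredholm) (hu : u.IsFredholm) :
    (v ∘L u).IsFredholm := by
  obtain ⟨u', hu'⟩ := hu.exists_isQuasiInverse
  obtain ⟨v', hv'⟩ := hv.exists_isQuasiInverse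
  exact .of_isQuasiInverse (v := u' ∘L v') (hu'.comp hv')

lemma fredholmIndex_congr {u v : E →L[ℂ] F} (hu : u.IsFredholm)
    (h : (u : E →ₗ[ℂ] F) ≈ v) : fredholmIndex u = fredholmIndex v := by
  have hv := hu.congr h
  have := hu.finite_ker
  have := hv.finite_ker
  have : FiniteDimensional ℂ (F ⧸ u.range) := hu.finite_coker
  have : FiniteDimensional ℂ (F ⧸ v.range) := hv.finite_coker
  exact LinearMap.index_eq_of_equiv h

lemma fredholmIndex_comp {u : E →L[ℂ] F} {v : F →L[ℂ] G} (hv : v.IsFredholm)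
    (hu : u.IsFredholm) : fredholmIndex (v ∘L u) = fredholmIndex v + fredholmIndex u := by
  have := hu.finite_ker
  have := hv.finite_ker
  have : FiniteDimensional ℂ (F ⧸ u.range) := hu.finite_coker
  have : FiniteDimensional ℂ (G ⧸ v.range) := hv.finite_coker
  exact LinearMap.index_comp (f := (u : E →ₗ[ℂ] F)) (v : F →ₗ[ℂ] G)

lemma _root_.ContinuousLinearEquiv.isFredholm (U : E ≃L[ℂ] F) : (U : E →L[ℂ] F).IsFredholm :=
  .of_isQuasiInverse (v := (U.symm : F →L[ℂ] E)) U.toLinearEquiv.isQuasiInverse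

lemma fredholmIndex_coe_equiv (U : E ≃L[ℂ] F) : fredholmIndex (U : E →L[ℂ] F) = 0 :=
  LinearEquiv.index_eq_zero (e := U.toLinearEquiv)

end ContinuousLinearMap

end Additivity

/-! ### Factorization modulo finite rank and additivity of the index -/

/-- Acute angles with sines `a` and `b` add up to less than a right angle exactly when `a² + b² < 1`, in
which case the product of their tangents is less than `1`. -/
lemma div_sqrt_mul_div_sqrt_lt_one {a b : ℝ} (h : a ^ 2 + b ^ 2 < 1) :
    a / √(1 - a ^ 2) * (b / √(1 - b ^ 2)) < 1 := by
  have ha' : 0 < 1 - a ^ 2 := by nlinarith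
  have hb' : 0 < 1 - b ^ 2 := by nlinarith
  rw [div_mul_div_comm, div_lt_one (by positivity), ← Real.sqrt_mul ha'.le]
  exact Real.lt_sqrt_of_sq_lt (by nlinarith)

section Triple

variable {H : Type*} [NormedAddCommGroup H] [InnerProductSpace ℂ H] [CompleteSpace H]

/-- Modulo finite rank, `P' : Ran P → Ran P'` factors through `Ran S` as `P' U S` with `U`
invertible. -/
lemma exists_pairOperator_equiv_comp {P P' S : H →L[ℂ] H}
    (hP : IsStarProjection P) (hP' : IsStarProjection P') (hS : IsStarProjection S)
    {G G' : H →L[ℂ] H} (hG : ‖G‖ ^ 2 + ‖G'‖ ^ 2 < 1)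
    (hPS : ((P - S : H →L[ℂ] H) : H →ₗ[ℂ] H) ≈ G)
    (hP'S : ((P' - S : H →L[ℂ] H) : H →ₗ[ℂ] H) ≈ G') :
    ∃ U : S.range ≃L[ℂ] S.range,
      (pairOperator P P' : P.range →ₗ[ℂ] P'.range) ≈
        (pairOperator S P' ∘L (U : S.range →L[ℂ] S.range) ∘L pairOperator P S :
          P.range →L[ℂ] P'.range) := by
  have := hP.completeSpace_range
  have := hP'.completeSpace_range
  have := hS.completeSpace_range
  have hG1 : ‖G‖ < 1 := by nlinarith [norm_nonneg G, sq_nonneg ‖G'‖]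
  have hG'1 : ‖G'‖ < 1 := by nlinarith [norm_nonneg G', sq_nonneg ‖G‖]
  obtain ⟨a, haA, hAa⟩ := (isFredholmPair_of_equiv hP hS hG1 hPS).exists_isQuasiInverse
  obtain ⟨b, hbB, hBb⟩ := (isFredholmPair_of_equiv hP' hS hG'1 hP'S).exists_isQuasiInverse
  obtain ⟨W, hW, hWeq⟩ := exists_tangent_equiv hP hS hG1 le_rfl hPS hAa
  obtain ⟨W', hW', hW'eq⟩ := exists_tangent_equiv hP' hS hG'1 le_rfl hP'S hBb
  set A := pairOperator P S
  set B := pairOperator P' S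
  set T := pairOperator P P'
  set D := (1 - S : H →L[ℂ] H) ∘L P.range.subtypeL ∘L a
  set D' := (1 - S : H →L[ℂ] H) ∘L P'.range.subtypeL ∘L b
  -- the two components along `Ran S` and its orthogonal complement
  have hsplit : b.adjoint ∘L T ∘L a = (B ∘L b).adjoint ∘L (A ∘L a) + D'.adjoint ∘L D := by
    refine ContinuousLinearMap.ext fun x => ext_inner_right ℂ fun y => ?_
    simp only [add_apply, comp_apply, inner_add_left, adjoint_inner_left]
    change ⟪P' (a x : H), (b y : H)⟫_ℂ =
      ⟪S (a x), S (b y)⟫_ℂ + ⟪(a x : H) - S (a x), (b y : H) - S (b y)⟫_ℂ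
    rw [hP'.inner_apply_left, hP'.apply_coe_range]
    exact hS.inner_eq_inner_add_inner _ _
  obtain ⟨U, hU⟩ := exists_continuousLinearEquiv_eq_one_sub (X := -(W'.adjoint ∘L W)) <| by
    rw [norm_neg]
    calc ‖W'.adjoint ∘L W‖ ≤ ‖W'.adjoint‖ * ‖W‖ := opNorm_comp_le _ _
      _ = ‖W'‖ * ‖W‖ := by rw [LinearIsometryEquiv.norm_map]
      _ ≤ (‖G'‖ / √(1 - ‖G'‖ ^ 2)) * (‖G‖ / √(1 - ‖G‖ ^ 2)) := by gcongr
      _ < 1 := div_sqrt_mul_div_sqrt_lt_one (by linarith)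
  have hmid : (b.adjoint ∘L T ∘L a : S.range →ₗ[ℂ] S.range) ≈ (U : S.range →L[ℂ] S.range) := by
    have h1 : ((B ∘L b).adjoint : S.range →ₗ[ℂ] S.range) ≈ .id := by
      have h := adjoint_equiv (u := B ∘L b) (v := ContinuousLinearMap.id ℂ S.range) hBb
      rwa [adjoint_id] at h
    have h2 : ((B ∘L b).adjoint : S.range →ₗ[ℂ] S.range) ∘ₗ
        (A ∘L a : S.range →ₗ[ℂ] S.range) ≈ .id := equiv_comp hAa h1
    have h3 := equiv_add h2 (equiv_comp hWeq (adjoint_equiv hW'eq))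
    rw [hU, hsplit]
    rwa [show ((1 - -(W'.adjoint ∘L W) : S.range →L[ℂ] S.range) : S.range →ₗ[ℂ] S.range) =
      LinearMap.id + (W'.adjoint : H →ₗ[ℂ] S.range) ∘ₗ (W : S.range →ₗ[ℂ] H) by
        rw [sub_neg_eq_add]; rfl]
  refine ⟨U, ?_⟩
  -- `T ≈ (B† b†) T (a A) = B† (b† T a) A ≈ B† U A`, where `B† = P' : Ran S → Ran P'`
  have hl : (pairOperator S P' : S.range →ₗ[ℂ] P'.range) ∘ₗ
      (b.adjoint : P'.range →ₗ[ℂ] S.range) ≈ .id := by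
    have h := adjoint_equiv (u := b ∘L B) (v := ContinuousLinearMap.id ℂ P'.range) hbB
    rwa [adjoint_id, adjoint_comp, adjoint_pairOperator hP' hS] at h
  have h1 := equiv_comp_left (u' := (pairOperator S P' : S.range →ₗ[ℂ] P'.range))
    (equiv_comp_right (u := (A : P.range →ₗ[ℂ] S.range)) hmid)
  have h2 := equiv_comp (equiv_comp_left (u' := (T : P.range →ₗ[ℂ] P'.range)) haA) hl
  exact Setoid.trans (Setoid.symm h2) h1

end Triple

theorem mainTheorem3 {H : Type*} [NormedAddCommGroup H] [InnerProductSpace ℂ H]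
    [CompleteSpace H] (P P' S : H →L[ℂ] H)
    (hP : IsStarProjection P) (hP' : IsStarProjection P') (hS : IsStarProjection S)
    (h : calkinNorm (P - S) ^ 2 + calkinNorm (P' - S) ^ 2 < 1) :
    IsFredholmPair P P' ∧ IsFredholmPair P S ∧ IsFredholmPair S P' ∧
      pairIndex P P' = pairIndex P S + pairIndex S P' := by
  -- the strict inequality leaves room to enlarge both Calkin norms by some `ε > 0`
  have hcont : Filter.Tendsto
      (fun ε : ℝ => (calkinNorm (P - S) + ε) ^ 2 + (calkinNorm (P' - S) + ε) ^ 2)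
      (nhdsWithin 0 (Set.Ioi 0)) (nhds (calkinNorm (P - S) ^ 2 + calkinNorm (P' - S) ^ 2)) := by
    refine Filter.Tendsto.mono_left (Continuous.tendsto' ?_ _ _ (by simp)) nhdsWithin_le_nhds
    fun_prop
  obtain ⟨ε, hε, hε0⟩ := ((hcont.eventually_lt_const h).and self_mem_nhdsWithin).exists
  replace hε0 : 0 < ε := hε0
  obtain ⟨G, hG, hPS⟩ := exists_equiv_of_calkinNorm_lt (lt_add_of_pos_right _ hε0 :
    calkinNorm (P - S) < calkinNorm (P - S) + ε)
  obtain ⟨G', hG', hP'S⟩ := exists_equiv_of_calkinNorm_lt (lt_add_of_pos_right _ hε0 :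
    calkinNorm (P' - S) < calkinNorm (P' - S) + ε)
  have hGG' : ‖G‖ ^ 2 + ‖G'‖ ^ 2 < 1 := lt_of_le_of_lt (by gcongr) hε
  have hG1 : ‖G‖ < 1 := by nlinarith [norm_nonneg G, sq_nonneg ‖G'‖]
  have hG'1 : ‖G'‖ < 1 := by nlinarith [norm_nonneg G', sq_nonneg ‖G‖]
  have hfred : IsFredholmPair P S := isFredholmPair_of_equiv hP hS hG1 hPS
  have hfred' : IsFredholmPair S P' :=
    isFredholmPair_of_equiv hS hP' (by rwa [norm_neg]) (sub_swap_equiv_neg hP'S)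
  obtain ⟨U, hU⟩ := exists_pairOperator_equiv_comp hP hP' hS hGG' hPS hP'S
  have hcomp : (pairOperator S P' ∘L (U : S.range →L[ℂ] S.range) ∘L
      pairOperator P S).IsFredholm := IsFredholm.comp hfred' (U.isFredholm.comp hfred)
  refine ⟨hcomp.congr (Setoid.symm hU), hfred, hfred', ?_⟩
  have hind := fredholmIndex_congr hcomp (Setoid.symm hU)
  rw [fredholmIndex_comp hfred' (U.isFredholm.comp hfred), fredholmIndex_comp U.isFredholm hfred,
    fredholmIndex_coe_equiv, zero_add, add_comm] at hind
  exact hind.symm
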